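/- Let $d,d'\ge 0$ be integers, let $R=\mathbb{C}[x_1,\dots,x_d]$ and $R'=\mathbb{C}[y_1,\dots,y_{d'}]$ be polynomial rings, and let $U,V$ be functors from the category of free $R$-modules of finite rank to the category of free $R'$-modules of finite rank whose action on homomorphisms is $\mathbb{C}$-linear. For $n\ge 0$ let $\mathrm{Hom}_n(U,V)$ be the complex vector space of all maps $\phi$ that assign to every sequence $$M_{n+1}\xleftarrow{f_n}M_n\xleftarrow{f_{n-1}}\cdots\xleftarrow{f_1}M_1$$ of $n$ composable homomorphisms of free $R$-modules of finite rank a homomorphism $\phi(f_n,\dots,f_1)\in\mathrm{Hom}_{R'}(U(M_1),V(M_{n+1}))$ (for $n=0$: to every $M_1$ a homomorphism $U(M_1)\to V(M_1)$), and that are $\mathbb{C}$-linear in each entry $f_i$. Let $\delta:\mathrm{Hom}_n(U,V)\to\mathrm{Hom}_{n+1}(U,V)$ be the differential $$(\delta\phi)(f_{n+1},\dots,f_1)=V(f_{n+1})\,\phi(f_n,\dots,f_1)+\sum_{j=1}^{n}(-1)^{j}\,\phi(f_{n+1},\dots,f_{n+2-j}f_{n+1-j},\dots,f_1)+(-1)^{n+1}\phi(f_{n+1},\dots,f_2)\,U(f_1).$$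 It satisfies $\delta\circ\delta=0$; let $H^n(\mathrm{Hom}(U,V))$ be the cohomology in degree $n$ of the cochain complex $(\mathrm{Hom}_\bullet(U,V),\delta)$. Then $$H^n(\mathrm{Hom}(U,V))\cong 0\qquad\text{for all } n>d .$$ -/

import Mathlib

open CategoryTheory

section HochschildMitchell

universe w v₁ v₂ u₁ u₂

section chainComp

variable {C : Type u₁} [Category.{v₁} C]

/-- For a chain of `n` composable morphisms `M 0 ⟶ M 1 ⟶ ⋯ ⟶ M n` and `a ≤ b`, the composite
`M a ⟶ M b` of the morphisms of the chain between the places `a` and `b`; it is the identity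
if `a = b`, and the given morphism if `b` is the successor of `a`. -/
noncomputable def chainComp {n : ℕ} {M : Fin (n + 1) → C}
    (f : ∀ i : Fin n, M i.castSucc ⟶ M i.succ) {a b : Fin (n + 1)} (h : a ≤ b) : M a ⟶ M b :=
  (ComposableArrows.mkOfObjOfMapSucc M f).map (homOfLE h)

variable {n : ℕ} {M : Fin (n + 1) → C} (f : ∀ i : Fin n, M i.castSucc ⟶ M i.succ)

theorem chainComp_self (a : Fin (n + 1)) : chainComp f (le_refl a) = 𝟙 (M a) :=
  (ComposableArrows.mkOfObjOfMapSucc M f).map_id a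

theorem chainComp_comp {a b c : Fin (n + 1)} (h : a ≤ b) (h' : b ≤ c) :
    chainComp f h ≫ chainComp f h' = chainComp f (h.trans h') :=
  ((ComposableArrows.mkOfObjOfMapSucc M f).map_comp (homOfLE h) (homOfLE h')).symm

theorem chainComp_succ (i : Fin n) : chainComp f i.castSucc_le_succ = f i :=
  ComposableArrows.mkOfObjOfMapSucc_map_succ M f i.1 i.2

/-- The composites of a chain are the only system of morphisms that is compatible with
composition and extends the chain. -/
theorem chainComp_unique
    (F : ∀ {a b : Fin (n + 1)}, a ≤ b → (M a ⟶ M b))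
    (h1 : ∀ a, F (le_refl a) = 𝟙 (M a))
    (h2 : ∀ {a b c : Fin (n + 1)} (h : a ≤ b) (h' : b ≤ c), F h ≫ F h' = F (h.trans h'))
    {a b : Fin (n + 1)} (h : a ≤ b)
    (h3 : ∀ i : Fin n, a ≤ i.castSucc → i.succ ≤ b → F i.castSucc_le_succ = f i) :
    chainComp f h = F h := by
  induction b using Fin.induction with
  | zero =>
    obtain rfl : a = 0 := le_antisymm h (Fin.zero_le _)
    rw [chainComp_self, h1]
  | succ i ih =>
    by_cases hi : a ≤ i.castSucc
    · rw [← chainComp_comp f hi i.castSucc_le_succ, ← h2 hi i.castSucc_le_succ, chainComp_succ,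
        h3 i hi le_rfl, ih hi fun j hj hj' => h3 j hj (hj'.trans i.castSucc_le_succ)]
    · obtain rfl : a = i.succ := le_antisymm h (Fin.castSucc_lt_iff_succ_le.1 (not_le.1 hi))
      rw [chainComp_self, h1]

theorem chainComp_update_of_not_mem [DecidableEq (Fin n)] (i : Fin n)
    (x : M i.castSucc ⟶ M i.succ) {a b : Fin (n + 1)} (h : a ≤ b)
    (hi : ¬ (a ≤ i.castSucc ∧ i.succ ≤ b)) :
    chainComp (Function.update f i x) h = chainComp f h := by
  refine chainComp_unique _ (fun h => chainComp f h) (chainComp_self f) (chainComp_comp f) h ?_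
  intro j hj hj'
  rw [chainComp_succ, Function.update_of_ne]
  rintro rfl
  exact hi ⟨hj, hj'⟩

theorem chainComp_update_of_mem [DecidableEq (Fin n)] (i : Fin n)
    (x : M i.castSucc ⟶ M i.succ) {a b : Fin (n + 1)} (ha : a ≤ i.castSucc) (hb : i.succ ≤ b) :
    chainComp (Function.update f i x) ((ha.trans i.castSucc_le_succ).trans hb) =
      chainComp f ha ≫ x ≫ chainComp f hb := by
  rw [← chainComp_comp _ (ha.trans i.castSucc_le_succ) hb,
    ← chainComp_comp _ ha i.castSucc_le_succ, chainComp_succ, Function.update_self,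
    chainComp_update_of_not_mem f i x ha (fun h => (Fin.castSucc_lt_succ (i := i)).not_ge h.2),
    chainComp_update_of_not_mem f i x hb (fun h => (Fin.castSucc_lt_succ (i := i)).not_ge h.1),
    Category.assoc]

/-- The chain `M (g 0) ⟶ M (g 1) ⟶ ⋯ ⟶ M (g m)` obtained from a chain
`M 0 ⟶ M 1 ⟶ ⋯ ⟶ M n` by keeping only the objects at the places `g 0 ≤ g 1 ≤ ⋯ ≤ g m`
and composing the morphisms in between. -/
noncomputable def chainRestrict {m : ℕ} (f : ∀ i : Fin n, M i.castSucc ⟶ M i.succ)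
    (g : Fin (m + 1) →o Fin (n + 1)) (j : Fin m) : M (g j.castSucc) ⟶ M (g j.succ) :=
  chainComp f (g.monotone j.castSucc_le_succ)

theorem chainComp_chainRestrict {m : ℕ} (g : Fin (m + 1) →o Fin (n + 1))
    {a b : Fin (m + 1)} (h : a ≤ b) :
    chainComp (M := fun j => M (g j)) (chainRestrict f g) h = chainComp f (g.monotone h) :=
  chainComp_unique (M := fun j => M (g j)) _ (fun h => chainComp f (g.monotone h))
    (fun _ => chainComp_self f _) (fun _ _ => chainComp_comp f _ _) h (fun _ _ _ => rfl)

theorem chainRestrict_update_of_mem {m : ℕ} (g : Fin (m + 1) →o Fin (n + 1))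
    [DecidableEq (Fin n)] [DecidableEq (Fin m)] (i : Fin n) (x : M i.castSucc ⟶ M i.succ)
    (j : Fin m) (ha : g j.castSucc ≤ i.castSucc) (hb : i.succ ≤ g j.succ) :
    chainRestrict (Function.update f i x) g =
      Function.update (β := fun j : Fin m => (M (g j.castSucc) ⟶ M (g j.succ)))
        (chainRestrict f g) j (chainComp f ha ≫ x ≫ chainComp f hb) := by
  funext j'
  by_cases hj : j' = j
  · subst hj
    rw [Function.update_self]
    exact chainComp_update_of_mem f i x ha hb
  · rw [Function.update_of_ne hj]
    refine chainComp_update_of_not_mem f i x _ fun h => ?_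
    rcases lt_or_gt_of_ne hj with hlt | hlt
    · exact (Fin.castSucc_lt_succ (i := i)).not_ge
        ((h.2.trans (g.monotone (Fin.succ_le_castSucc_iff.2 hlt))).trans ha)
    · exact (Fin.castSucc_lt_succ (i := i)).not_ge
        ((hb.trans (g.monotone (Fin.succ_le_castSucc_iff.2 hlt))).trans h.1)

theorem chainRestrict_update_of_not_mem {m : ℕ} (g : Fin (m + 1) →o Fin (n + 1))
    [DecidableEq (Fin n)] (i : Fin n) (x : M i.castSucc ⟶ M i.succ)
    (h : ¬ (g 0 ≤ i.castSucc ∧ i.succ ≤ g (Fin.last m))) :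
    chainRestrict (Function.update f i x) g = chainRestrict f g := by
  funext j
  exact chainComp_update_of_not_mem f i x _ fun h' =>
    h ⟨(g.monotone (Fin.zero_le _)).trans h'.1, h'.2.trans (g.monotone (Fin.le_last _))⟩

theorem exists_gap {m : ℕ} (g : Fin (m + 1) →o Fin (n + 1)) (i : Fin n)
    (h0 : g 0 ≤ i.castSucc) (h1 : i.succ ≤ g (Fin.last m)) :
    ∃ j : Fin m, g j.castSucc ≤ i.castSucc ∧ i.succ ≤ g j.succ := by
  by_contra! H
  have key : ∀ a : Fin (m + 1), g a ≤ i.castSucc := by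
    intro a
    induction a using Fin.induction with
    | zero => exact h0
    | succ j ih => exact Fin.le_castSucc_iff.2 (H j ih)
  exact (Fin.castSucc_lt_succ (i := i)).not_ge (h1.trans (key _))

end chainComp

variable {k : Type w} [CommRing k]
variable {C : Type u₁} [Category.{v₁} C] [Preadditive C] [CategoryTheory.Linear k C]
variable {D : Type u₂} [Category.{v₂} D] [Preadditive D] [CategoryTheory.Linear k D]

variable (k) in
/-- The space `Hom_n(U,V)` of morphisms of degree `n` between two functors `U` and `V`: a map that
associates to any sequence `M 0 ⟶ M 1 ⟶ ⋯ ⟶ M n` of `n` composable morphisms a morphism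
`U (M 0) ⟶ V (M n)`, and that is `k`-linear in each of the `n` entries. -/
abbrev HomDeg (U V : C ⥤ D) (n : ℕ) : Type (max u₁ v₁ v₂) :=
  ∀ M : Fin (n + 1) → C,
    MultilinearMap k (fun i : Fin n => (M i.castSucc ⟶ M i.succ))
      (U.obj (M 0) ⟶ V.obj (M (Fin.last n)))

namespace HomDeg

variable {U V : C ⥤ D}

/-- The value of `pull g φ` (see below) on the chain `f`. -/
noncomputable def pullFun {m n : ℕ} (g : Fin (m + 1) →o Fin (n + 1)) (φ : HomDeg k U V m)
    (M : Fin (n + 1) → C) (f : ∀ i : Fin n, M i.castSucc ⟶ M i.succ) :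
    U.obj (M 0) ⟶ V.obj (M (Fin.last n)) :=
  U.map (chainComp f (Fin.zero_le (g 0))) ≫ φ (fun j => M (g j)) (chainRestrict f g) ≫
    V.map (chainComp f (Fin.le_last (g (Fin.last m))))

/-- `pullFun g φ M f` is linear in each of the morphisms of the chain `f`. -/
theorem pullFun_update [U.Additive] [U.Linear k] [V.Additive] [V.Linear k] {m n : ℕ}
    (g : Fin (m + 1) →o Fin (n + 1)) (φ : HomDeg k U V m)
    (M : Fin (n + 1) → C) [DecidableEq (Fin n)] (f : ∀ i : Fin n, M i.castSucc ⟶ M i.succ)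
    (i : Fin n) :
    ∃ L : (M i.castSucc ⟶ M i.succ) →ₗ[k] (U.obj (M 0) ⟶ V.obj (M (Fin.last n))),
      ∀ x, pullFun g φ M (Function.update f i x) = L x := by
  by_cases h0 : g 0 ≤ i.castSucc
  · by_cases h1 : i.succ ≤ g (Fin.last m)
    · obtain ⟨j, hj, hj'⟩ := exists_gap g i h0 h1
      refine ⟨Linear.rightComp k _ (V.map (chainComp f (Fin.le_last (g (Fin.last m))))) ∘ₗ
        Linear.leftComp k _ (U.map (chainComp f (Fin.zero_le (g 0)))) ∘ₗ
        (φ (fun j => M (g j))).toLinearMap (chainRestrict f g) j ∘ₗ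
        Linear.leftComp k _ (chainComp f hj) ∘ₗ Linear.rightComp k _ (chainComp f hj'),
        fun x => ?_⟩
      rw [pullFun, chainRestrict_update_of_mem f g i x j hj hj',
        chainComp_update_of_not_mem f i x _ (fun h =>
          (Fin.castSucc_lt_succ (i := i)).not_ge (h.2.trans h0)),
        chainComp_update_of_not_mem f i x _ (fun h =>
          (Fin.castSucc_lt_succ (i := i)).not_ge (h1.trans h.1))]
      simp
    · have h1' : g (Fin.last m) ≤ i.castSucc := Fin.le_castSucc_iff.2 (not_le.1 h1)
      refine ⟨Linear.leftComp k _ (U.map (chainComp f (Fin.zero_le (g 0)))) ∘ₗ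
        Linear.leftComp k _ (φ (fun j => M (g j)) (chainRestrict f g)) ∘ₗ
        V.mapLinearMap k ∘ₗ Linear.leftComp k _ (chainComp f h1') ∘ₗ
        Linear.rightComp k _ (chainComp f (Fin.le_last i.succ)), fun x => ?_⟩
      rw [pullFun, chainRestrict_update_of_not_mem f g i x (fun h => h1 h.2),
        chainComp_update_of_mem f i x h1' (Fin.le_last i.succ),
        chainComp_update_of_not_mem f i x _ (fun h =>
          (Fin.castSucc_lt_succ (i := i)).not_ge (h.2.trans h0))]
      simp
  · have h0' : i.succ ≤ g 0 := Fin.castSucc_lt_iff_succ_le.1 (not_le.1 h0)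
    refine ⟨Linear.rightComp k _ (φ (fun j => M (g j)) (chainRestrict f g) ≫
        V.map (chainComp f (Fin.le_last (g (Fin.last m))))) ∘ₗ
      U.mapLinearMap k ∘ₗ Linear.leftComp k _ (chainComp f (Fin.zero_le i.castSucc)) ∘ₗ
      Linear.rightComp k _ (chainComp f h0'), fun x => ?_⟩
    rw [pullFun, chainRestrict_update_of_not_mem f g i x (fun h => h0 h.1),
      chainComp_update_of_mem f i x (Fin.zero_le _) h0',
      chainComp_update_of_not_mem f i x _ (fun h => h0 ((g.monotone (Fin.zero_le _)).trans h.1))]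
    simp

variable [U.Additive] [U.Linear k] [V.Additive] [V.Linear k]

/-- For places `g 0 ≤ g 1 ≤ ⋯ ≤ g m` in `0, …, n`, the map `Hom_m(U,V) → Hom_n(U,V)` that applies
`φ` to the restricted chain `M (g 0) ⟶ ⋯ ⟶ M (g m)`, precomposes with `U` of the morphisms of the
chain before the place `g 0`, and postcomposes with `V` of the morphisms after the place `g m`. -/
noncomputable def pull {m n : ℕ} (g : Fin (m + 1) →o Fin (n + 1)) :
    HomDeg k U V m →ₗ[k] HomDeg k U V n where
  toFun φ M :=
    { toFun := pullFun g φ M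
      map_update_add' := fun f i x y => by
        obtain ⟨L, hL⟩ := pullFun_update g φ M f i
        simp only [hL, map_add]
      map_update_smul' := fun f i c x => by
        obtain ⟨L, hL⟩ := pullFun_update g φ M f i
        simp only [hL, map_smul] }
  map_add' φ ψ := by
    funext M
    ext f
    simp [pullFun]
  map_smul' c φ := by
    funext M
    ext f
    simp [pullFun]

theorem pull_comp {l m n : ℕ} (g : Fin (m + 1) →o Fin (n + 1)) (h : Fin (l + 1) →o Fin (m + 1))
    (φ : HomDeg k U V l) : pull g (pull h φ) = pull (g.comp h) φ := by
  funext M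
  ext f
  have e : chainRestrict (M := fun j => M (g j)) (chainRestrict f g) h =
      chainRestrict f (g.comp h) := by
    funext j
    exact chainComp_chainRestrict f g _
  change U.map _ ≫ (U.map (chainComp (M := fun j => M (g j)) (chainRestrict f g) _) ≫
    φ (fun j => M (g (h j))) (chainRestrict (M := fun j => M (g j)) (chainRestrict f g) h) ≫
    V.map (chainComp (M := fun j => M (g j)) (chainRestrict f g) _)) ≫ V.map _ =
    U.map _ ≫ φ (fun j => M (g (h j))) (chainRestrict f (g.comp h)) ≫ V.map _
  rw [e, chainComp_chainRestrict, chainComp_chainRestrict]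
  simp only [Category.assoc, ← U.map_comp_assoc, ← V.map_comp, chainComp_comp]
  rfl

/-- The differential `d : Hom_n(U,V) → Hom_{n+1}(U,V)`. For a chain
`f_1 : M 0 ⟶ M 1`, …, `f_{n+1} : M n ⟶ M (n+1)` it reads (in the notation for composition from
right to left)

`(dφ)(f_{n+1}, …, f_1) = V(f_{n+1}) φ(f_n, …, f_1) - φ(f_{n+1} f_n, f_{n-1}, …, f_1) + ⋯
  + (-1)^n φ(f_{n+1}, …, f_3, f_2 f_1) + (-1)^{n+1} φ(f_{n+1}, …, f_2) U(f_1)`.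

The `j`-th summand (`j = 0, …, n+1`) leaves out the object at the place `n+1-j`. If this is the
last (the first) object, then the morphism next to it is acted on by `V` (by `U`) and composed
with the value of `φ`; otherwise the two morphisms next to it are composed, and the outer factors
`U(…)`, `V(…)` of `pull` are identities. -/
noncomputable def differential (n : ℕ) : HomDeg k U V n →ₗ[k] HomDeg k U V (n + 1) :=
  ∑ j : Fin (n + 2), (-1 : k) ^ (j : ℕ) • pull (Fin.succAboveOrderEmb j.rev).toOrderHom

theorem differential_eq (n : ℕ) (φ : HomDeg k U V n) :
    differential n φ = (-1 : k) ^ (n + 1) •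
      ∑ i : Fin (n + 2), (-1 : k) ^ (i : ℕ) • pull (Fin.succAboveOrderEmb i).toOrderHom φ := by
  simp only [differential, LinearMap.coe_sum, Finset.sum_apply, LinearMap.smul_apply,
    Finset.smul_sum, smul_smul]
  refine Fintype.sum_equiv Fin.revPerm _ _ fun j => ?_
  simp only [Fin.revPerm_apply]
  congr 1
  obtain ⟨c, hc⟩ : ∃ c, n + 1 = j + c := ⟨n + 1 - j, by lia⟩
  rw [Fin.val_rev, show n + 2 - (j + 1) = c by lia, hc, pow_add, mul_assoc, ← pow_add,
    Even.neg_one_pow ⟨c, rfl⟩, mul_one]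

theorem differential_differential (n : ℕ) (φ : HomDeg k U V n) :
    differential (n + 1) (differential n φ) = 0 := by
  suffices h : (∑ i : Fin (n + 3), ∑ j : Fin (n + 2), ((-1 : k) ^ (i : ℕ) * (-1) ^ (j : ℕ)) •
      pull (((Fin.succAboveOrderEmb i).toOrderHom).comp (Fin.succAboveOrderEmb j).toOrderHom) φ)
        = 0 by
    rw [differential_eq, differential_eq]
    simp only [map_smul, map_sum, pull_comp]
    simp only [Finset.smul_sum, smul_smul] at h ⊢
    have h' := congrArg (fun x => ((-1 : k) ^ (n + 1 + 1) * (-1) ^ (n + 1)) • x) h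
    simp only [Finset.smul_sum, smul_smul, smul_zero] at h'
    refine Eq.trans ?_ h'
    refine Finset.sum_congr rfl fun i _ => Finset.sum_congr rfl fun j _ => ?_
    congr 1
    ring
  have swap : ∀ i j : Fin (n + 2), j ≤ i →
      ((Fin.succAboveOrderEmb i.succ).toOrderHom).comp (Fin.succAboveOrderEmb j).toOrderHom =
      ((Fin.succAboveOrderEmb j.castSucc).toOrderHom).comp
        (Fin.succAboveOrderEmb i).toOrderHom := by
    intro i j hij
    ext x
    simp only [OrderHom.comp_coe, OrderEmbedding.toOrderHom_coe, Function.comp_apply,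
      Fin.succAboveOrderEmb_apply, Fin.succAbove, Fin.lt_def, Fin.le_def] at hij ⊢
    split_ifs <;> simp_all <;> lia
  rw [← Finset.sum_product', Finset.univ_product_univ]
  let S : Finset (Fin (n + 3) × Fin (n + 2)) := {p | p.1 ≤ p.2.castSucc}
  rw [← Finset.sum_add_sum_compl S, ← eq_neg_iff_add_eq_zero, ← Finset.sum_neg_distrib]
  refine Finset.sum_bij (fun p hp => (p.2.succ, p.1.castPred (Fin.ne_last_of_lt
      (lt_of_le_of_lt (Finset.mem_filter.1 hp).2 Fin.castSucc_lt_succ)))) ?_ ?_ ?_ ?_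
  · rintro ⟨i, j⟩ hp
    simp only [S, Finset.mem_compl, Finset.mem_filter, Finset.mem_univ, true_and, not_le,
      Fin.le_def, Fin.val_succ, Fin.val_castSucc, Fin.coe_castPred] at hp ⊢
    lia
  · rintro ⟨i, j⟩ hp ⟨i', j'⟩ hp' h
    simp only [Prod.mk.injEq, Fin.succ_inj, Fin.castPred_inj] at h
    rw [h.1, h.2]
  · rintro ⟨i, j⟩ hp
    simp only [S, Finset.mem_compl, Finset.mem_filter, Finset.mem_univ, true_and, not_le] at hp
    refine ⟨(j.castSucc, i.pred (Fin.ne_zero_of_lt hp)), ?_, ?_⟩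
    · simp only [S, Finset.mem_filter, Finset.mem_univ, true_and, Fin.lt_def, Fin.le_def,
        Fin.val_castSucc, Fin.val_pred] at hp ⊢
      lia
    · simp
  · rintro ⟨i, j⟩ hp
    have hij : i ≤ j.castSucc := (Finset.mem_filter.1 hp).2
    obtain ⟨i, rfl⟩ := Fin.exists_castSucc_eq.2
      (Fin.ne_last_of_lt (lt_of_le_of_lt hij Fin.castSucc_lt_succ))
    simp only [Fin.castPred_castSucc]
    rw [swap j i (Fin.castSucc_le_castSucc_iff.1 hij), ← neg_smul]
    congr 1
    simp only [Fin.val_succ, Fin.val_castSucc]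
    ring

end HomDeg

/-- The cochain complex `Hom_0(U,V) ⟶ Hom_1(U,V) ⟶ Hom_2(U,V) ⟶ ⋯` of `k`-modules; its homology
in degree `n` is `H^n(Hom(U,V))`. -/
noncomputable def homComplex (U V : C ⥤ D) [U.Additive] [U.Linear k] [V.Additive] [V.Linear k] :
    CochainComplex (ModuleCat.{max u₁ v₁ v₂} k) ℕ :=
  CochainComplex.of (fun n => ModuleCat.of k (HomDeg k U V n))
    (fun n => ModuleCat.ofHom (HomDeg.differential n)) (fun n => by
      ext φ : 2
      exact HomDeg.differential_differential n φ)

end HochschildMitchell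

/-- The category of free modules of finite rank over a commutative ring `R`
(a full subcategory of the category of `R`-modules). -/
abbrev FreeFinMod.{v, u} (R : Type u) [CommRing R] : Type (max u (v + 1)) :=
  ObjectProperty.FullSubcategory
    (fun M : ModuleCat.{v} R => Module.Free R M ∧ Module.Finite R M)

universe u v

/-!
`Hom(U,V)` computes Hochschild–Mitchell cohomology, and the statement says that the polynomial ring
`R = k[x_1, …, x_d]` has a resolution of length `d` by projective bimodules, namely the Koszul
resolution. The argument applies this resolution to the functor `U` and keeps `V` fixed.

Composing `U` and `V` with the embedding of free `R'`-modules into all `R'`-modules does not change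
the complex (`HomDeg.VanishesAbove.of_comp`), so quotients and kernels are available. Let
`N = U(R)`: a projective `R'`-module on which `R` acts through endomorphisms of the module `R`.
For a subalgebra `S` of `R` consider the functor `X ↦ N ⊗[S] X`.

* For `S = k` it is induced from `N`, and a contraction, which puts the morphism `R ⟶ M 0` given by
  an element of `M 0` in front of a chain, shows that the cohomology vanishes in positive degrees
  (`HomDeg.vanishesAbove_of_isInduced`).
* Let `S` be generated by some of the variables, and let `S'` be generated by `S` and a further
  variable `x`. Then `0 ⟶ N ⊗[S] X ⟶ N ⊗[S] X ⟶ N ⊗[S'] X ⟶ 0` is exact for every free `X`, where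
  the first map is `n ⊗ z ↦ x n ⊗ z - n ⊗ x z`. It is injective by a comparison of terms of highest
  degree in `x` (`TensorProduct.actionDiff_injective`). As `N ⊗[S'] X` is a direct sum of copies of
  `N`, hence projective over `R'`, the sequence splits over `R'` for each `X`; so cochains extend
  and descend along it, and by the long exact sequence (`HomDeg.VanishesAbove.of_shortExact`) the
  bound on the degree of nonzero cohomology rises by at most one.
* For `S = R` the functor is isomorphic to `U`, because `U` is additive and `X` is free of finite
  rank (`FreeFinMod.evalTrans_app_bijective`).

After all `d` variables have been adjoined, the cohomology vanishes in degrees greater than `d`.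
-/

/-! ### Cochains under change of functors, and the long exact sequence -/

universe w v₁ v₂ v₃ u₁ u₂ u₃

namespace HomDeg

variable {k : Type w} [CommRing k]
variable {C : Type u₁} [Category.{v₁} C] [Preadditive C] [CategoryTheory.Linear k C]
variable {D : Type u₂} [Category.{v₂} D] [Preadditive D] [CategoryTheory.Linear k D]
variable {E : Type u₃} [Category.{v₃} E] [Preadditive E] [CategoryTheory.Linear k E]
variable {U U' U'' V : C ⥤ D} {n : ℕ}

/-- Precomposition of the values of a cochain with a family of morphisms `U X ⟶ U' X`, which need
not be natural. -/
noncomputable def precomp (r : ∀ X, U.obj X ⟶ U'.obj X) :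
    HomDeg k U' V n →ₗ[k] HomDeg k U V n where
  toFun φ M := (Linear.leftComp k _ (r (M 0))).compMultilinearMap (φ M)
  map_add' φ ψ := by
    funext M
    ext f
    simp
  map_smul' c φ := by
    funext M
    ext f
    simp

@[simp]
theorem precomp_apply (r : ∀ X, U.obj X ⟶ U'.obj X) (φ : HomDeg k U' V n) (M : Fin (n + 1) → C)
    (f : ∀ i : Fin n, M i.castSucc ⟶ M i.succ) :
    precomp r φ M f = r (M 0) ≫ φ M f :=
  rfl

/-- Postcomposition of the functors with `G : D ⥤ E` acts on cochains by applying `G` to values. -/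
noncomputable def mapValues (G : D ⥤ E) [G.Additive] [G.Linear k] :
    HomDeg k U V n →ₗ[k] HomDeg k (U ⋙ G) (V ⋙ G) n where
  toFun φ M := (G.mapLinearMap k).compMultilinearMap (φ M)
  map_add' φ ψ := by
    funext M
    ext f
    simp
  map_smul' c φ := by
    funext M
    ext f
    simp

@[simp]
theorem mapValues_apply (G : D ⥤ E) [G.Additive] [G.Linear k] (φ : HomDeg k U V n)
    (M : Fin (n + 1) → C) (f : ∀ i : Fin n, M i.castSucc ⟶ M i.succ) :
    mapValues G φ M f = G.map (φ M f) :=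
  rfl

theorem mapValues_bijective (G : D ⥤ E) [G.Additive] [G.Linear k] [G.Full] [G.Faithful] :
    Function.Bijective (mapValues G : HomDeg k U V n →ₗ[k] _) := by
  have hG (X Y : D) : Function.Bijective (G.mapLinearMap k (X := X) (Y := Y)) :=
    ⟨fun _ _ h => G.map_injective h, fun f => G.map_surjective f⟩
  refine ⟨fun φ ψ h => ?_, fun φ => ?_⟩
  · funext M
    ext f
    have := congrArg (fun x : HomDeg k (U ⋙ G) (V ⋙ G) n => x M f) h
    exact G.map_injective this
  · refine ⟨fun M => (LinearEquiv.ofBijective _ (hG _ _)).symm.toLinearMap.compMultilinearMap (φ M),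
      ?_⟩
    funext M
    ext f
    exact (LinearEquiv.ofBijective _ (hG _ _)).apply_symm_apply (φ M f)

variable [U.Additive] [U.Linear k] [U'.Additive] [U'.Linear k] [U''.Additive] [U''.Linear k]
  [V.Additive] [V.Linear k]

theorem pull_apply {m n : ℕ} (g : Fin (m + 1) →o Fin (n + 1)) (φ : HomDeg k U V m)
    (M : Fin (n + 1) → C) (f : ∀ i : Fin n, M i.castSucc ⟶ M i.succ) :
    pull g φ M f = U.map (chainComp f (Fin.zero_le (g 0))) ≫
      φ (fun j => M (g j)) (chainRestrict f g) ≫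
      V.map (chainComp f (Fin.le_last (g (Fin.last m)))) :=
  rfl

theorem precomp_pull (α : U ⟶ U') {m n : ℕ} (g : Fin (m + 1) →o Fin (n + 1))
    (φ : HomDeg k U' V m) : precomp α.app (pull g φ) = pull g (precomp α.app φ) := by
  funext M
  ext f
  simp [pull_apply]

theorem precomp_differential (α : U ⟶ U') (φ : HomDeg k U' V n) :
    precomp α.app (differential n φ) = differential n (precomp α.app φ) := by
  simp only [differential_eq, map_smul, map_sum, precomp_pull]

theorem mapValues_pull (G : D ⥤ E) [G.Additive] [G.Linear k] {m n : ℕ}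
    (g : Fin (m + 1) →o Fin (n + 1)) (φ : HomDeg k U V m) :
    mapValues G (pull g φ) = pull g (mapValues G φ) := by
  funext M
  ext f
  rw [mapValues_apply]
  change _ = G.map (U.map (chainComp f (Fin.zero_le (g 0)))) ≫
    G.map (φ (fun j => M (g j)) (chainRestrict f g)) ≫
    G.map (V.map (chainComp f (Fin.le_last (g (Fin.last m)))))
  simp [pull_apply]

theorem mapValues_differential (G : D ⥤ E) [G.Additive] [G.Linear k] (φ : HomDeg k U V n) :
    mapValues G (differential n φ) = differential n (mapValues G φ) := by
  simp only [differential_eq, map_smul, map_sum, mapValues_pull]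

variable (k U V) in
/-- The cohomology of `Hom(U,V)` vanishes in all degrees greater than `m`: the cocycles of these
degrees are coboundaries. -/
def VanishesAbove (m : ℕ) : Prop :=
  ∀ n, m ≤ n → ∀ φ : HomDeg k U V (n + 1), differential (n + 1) φ = 0 →
    ∃ ψ : HomDeg k U V n, differential n ψ = φ

theorem VanishesAbove.of_comp (G : D ⥤ E) [G.Additive] [G.Linear k] [G.Full] [G.Faithful]
    {m : ℕ} (h : VanishesAbove k (U ⋙ G) (V ⋙ G) m) : VanishesAbove k U V m := by
  intro n hn φ hφ
  obtain ⟨ψ, hψ⟩ := h n hn (mapValues G φ) (by rw [← mapValues_differential, hφ, map_zero])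
  obtain ⟨ψ, rfl⟩ := (mapValues_bijective G).2 ψ
  exact ⟨ψ, (mapValues_bijective G).1 (by rw [mapValues_differential, hψ])⟩

theorem VanishesAbove.of_iso (e : U ≅ U') {m : ℕ} (h : VanishesAbove k U V m) :
    VanishesAbove k U' V m := by
  intro n hn φ hφ
  obtain ⟨ψ, hψ⟩ := h n hn (precomp e.hom.app φ)
    (by rw [← precomp_differential, hφ, map_zero])
  refine ⟨precomp e.inv.app ψ, ?_⟩
  rw [← precomp_differential, hψ]
  funext M
  ext f
  simp

/-- The part of the long exact cohomology sequence of a pointwise split short exact sequence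
`0 ⟶ U ⟶ U' ⟶ U'' ⟶ 0` which bounds the cohomology of `Hom(U'',V)`. -/
theorem VanishesAbove.of_shortExact (i : U ⟶ U') (p : U' ⟶ U'')
    (r : ∀ X, U'.obj X ⟶ U.obj X) (s : ∀ X, U''.obj X ⟶ U'.obj X)
    (hip : ∀ X, i.app X ≫ p.app X = 0) (hir : ∀ X, i.app X ≫ r X = 𝟙 _)
    (hsp : ∀ X, s X ≫ p.app X = 𝟙 _) (hrs : ∀ X, r X ≫ i.app X + p.app X ≫ s X = 𝟙 _)
    {m : ℕ} (h : VanishesAbove k U V m) (h' : VanishesAbove k U' V m) :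
    VanishesAbove k U'' V (m + 1) := by
  intro n hn φ hφ
  obtain ⟨n, rfl⟩ : ∃ l, n = l + 1 := ⟨n - 1, by lia⟩
  obtain ⟨ψ, hψ⟩ := h' (n + 1) (by lia) (precomp p.app φ)
    (by rw [← precomp_differential, hφ, map_zero])
  obtain ⟨χ, hχ⟩ := h n (by lia) (precomp i.app ψ) (by
    rw [← precomp_differential, hψ]
    funext M
    ext f
    simp [reassoc_of% hip])
  -- Correcting `ψ` by the coboundary of an extension of `χ` makes it descend to `U''`.
  let ψ' := ψ - differential n (precomp r χ)
  have hi : precomp i.app ψ' = 0 := by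
    have : precomp i.app (precomp r χ) = χ := by
      funext M
      ext f
      simp [reassoc_of% hir]
    rw [map_sub, precomp_differential, this, hχ, sub_self]
  have hp : precomp p.app (precomp s ψ') = ψ' := by
    funext M
    ext f
    have h0 : i.app (M 0) ≫ ψ' M f = 0 :=
      congrArg (fun x : HomDeg k U V (n + 1) => x M f) hi
    have h1 := congrArg (fun x => x ≫ ψ' M f) (hrs (M 0))
    simpa [h0] using h1
  refine ⟨precomp s ψ', ?_⟩
  have inj (φ₁ φ₂ : HomDeg k U'' V (n + 2)) (e : precomp p.app φ₁ = precomp p.app φ₂) :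
      φ₁ = φ₂ := by
    have := congrArg (precomp s) e
    have key (φ : HomDeg k U'' V (n + 2)) : precomp s (precomp p.app φ) = φ := by
      funext M
      ext f
      simp [reassoc_of% hsp]
    simpa only [key] using this
  apply inj
  rw [precomp_differential, hp, map_sub, differential_differential, sub_zero, hψ]

theorem VanishesAbove.isZero_homology {m : ℕ} (h : VanishesAbove k U V m) {n : ℕ} (hn : m < n) :
    Limits.IsZero ((homComplex (k := k) U V).homology n) := by
  obtain ⟨n, rfl⟩ : ∃ l, n = l + 1 := ⟨n - 1, by lia⟩
  have hd (l : ℕ) : (homComplex (k := k) U V).d l (l + 1) = ModuleCat.ofHom (differential l) :=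
    by
    dsimp only [homComplex]
    exact CochainComplex.of_d (fun n => ModuleCat.of k (HomDeg k U V n))
      (fun n => ModuleCat.ofHom (differential n)) l
  rw [← HomologicalComplex.exactAt_iff_isZero_homology,
    HomologicalComplex.exactAt_iff' _ n (n + 1) (n + 2) (by simp) (by simp),
    ShortComplex.moduleCat_exact_iff]
  intro φ hφ
  change (homComplex (k := k) U V).d (n + 1) (n + 2) φ = 0 at hφ
  change ∃ ψ, (homComplex (k := k) U V).d n (n + 1) ψ = φ
  rw [hd] at hφ ⊢
  exact h n (by lia) φ hφ

end HomDeg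

/-! ### The contraction for induced functors -/

section Cons

/-- The objects `P, M 0, …, M n` of a chain extended to the left. -/
def consObj {C : Type u₁} {n : ℕ} (P : C) (M : Fin (n + 1) → C) : Fin (n + 2) → C :=
  Fin.cases P M

/-- The order preserving map that fixes the new first place and is `g` on the other places. -/
def consHom {m n : ℕ} (g : Fin (m + 1) →o Fin (n + 1)) : Fin (m + 2) →o Fin (n + 2) where
  toFun := Fin.cases 0 fun j => (g j).succ
  monotone' a b h := by
    cases a using Fin.cases with
    | zero => exact Fin.zero_le _
    | succ a =>
      cases b using Fin.cases with
      | zero => exact absurd h (by simp)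
      | succ b => exact Fin.succ_le_succ_iff.2 (g.monotone (Fin.succ_le_succ_iff.1 h))

theorem succAboveOrderEmb_succ_toOrderHom {n : ℕ} (i : Fin (n + 2)) :
    (Fin.succAboveOrderEmb i.succ).toOrderHom = consHom (Fin.succAboveOrderEmb i).toOrderHom := by
  ext j
  cases j using Fin.cases <;> simp [consHom]

theorem consObj_comp_consHom {C : Type u₁} {m n : ℕ} (P : C) (M : Fin (n + 1) → C)
    (g : Fin (m + 1) →o Fin (n + 1)) :
    (fun j => consObj P M (consHom g j)) = consObj P fun j => M (g j) := by
  funext j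
  cases j using Fin.cases <;> rfl

variable {C : Type u₁} [Category.{v₁} C]

/-- The chain `P ⟶ M 0 ⟶ ⋯ ⟶ M n` obtained by putting `x : P ⟶ M 0` in front of a chain. -/
def consChain {n : ℕ} {P : C} {M : Fin (n + 1) → C} (x : P ⟶ M 0)
    (f : ∀ i : Fin n, M i.castSucc ⟶ M i.succ) (i : Fin (n + 1)) :
    consObj P M i.castSucc ⟶ consObj P M i.succ :=
  Fin.cases (motive := fun i : Fin (n + 1) => consObj P M i.castSucc ⟶ consObj P M i.succ) x f i

variable {n : ℕ} {P : C} {M : Fin (n + 1) → C} (x : P ⟶ M 0)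
  (f : ∀ i : Fin n, M i.castSucc ⟶ M i.succ)

theorem chainComp_consChain_succ {a b : Fin (n + 1)} (h : a ≤ b) :
    chainComp (consChain x f) (Fin.succ_le_succ_iff.2 h) = chainComp f h :=
  (chainComp_unique f (fun {_ _} h => chainComp (consChain x f) (Fin.succ_le_succ_iff.2 h))
    (fun a => chainComp_self (consChain x f) a.succ)
    (fun _ _ => chainComp_comp (consChain x f) _ _) h
    (fun i _ _ => chainComp_succ (consChain x f) i.succ)).symm

theorem chainComp_consChain_zero (a : Fin (n + 1)) :
    chainComp (consChain x f) (Fin.zero_le a.succ) = x ≫ chainComp f (Fin.zero_le a) := by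
  rw [← chainComp_consChain_succ x f (Fin.zero_le a),
    ← chainComp_comp (consChain x f) (b := (0 : Fin (n + 1)).succ) (Fin.zero_le _)
      (Fin.succ_le_succ_iff.2 (Fin.zero_le a))]
  congr 1
  exact chainComp_succ (consChain x f) 0

theorem chainRestrict_consChain {m : ℕ} (g : Fin (m + 1) →o Fin (n + 1)) :
    HEq (chainRestrict (consChain x f) (consHom g))
      (consChain (P := P) (M := fun j => M (g j)) (x ≫ chainComp f (Fin.zero_le (g 0)))
        (chainRestrict f g)) := by
  refine Function.hfunext rfl fun j j' hj => ?_
  obtain rfl := eq_of_heq hj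
  cases j using Fin.cases with
  | zero => exact heq_of_eq (chainComp_consChain_zero x f (g 0))
  | succ j => exact heq_of_eq (chainComp_consChain_succ x f (g.monotone j.castSucc_le_succ))

theorem consChain_update [DecidableEq (Fin n)] [DecidableEq (Fin (n + 1))] (i : Fin n)
    (y : M i.castSucc ⟶ M i.succ) :
    consChain x (Function.update f i y) =
      Function.update (β := fun i : Fin (n + 1) => consObj P M i.castSucc ⟶ consObj P M i.succ)
        (consChain x f) i.succ y := by
  funext j
  cases j using Fin.cases with
  | zero => exact (Function.update_of_ne (Fin.succ_ne_zero i).symm _ _).symm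
  | succ j =>
    by_cases h : j = i
    · subst h
      exact (Function.update_self j y f).trans (Function.update_self
        (β := fun i : Fin (n + 1) => consObj P M i.castSucc ⟶ consObj P M i.succ)
        j.succ y (consChain x f)).symm
    · exact (Function.update_of_ne h y f).trans (Function.update_of_ne
        (β := fun i : Fin (n + 1) => consObj P M i.castSucc ⟶ consObj P M i.succ)
        (fun e => h (Fin.succ_injective _ e)) y (consChain x f)).symm

theorem consChain_zero_update [DecidableEq (Fin (n + 1))] (y : P ⟶ M 0) :
    consChain y f =
      Function.update (β := fun i : Fin (n + 1) => consObj P M i.castSucc ⟶ consObj P M i.succ)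
        (consChain x f) 0 y := by
  funext j
  cases j using Fin.cases with
  | zero =>
    exact (Function.update_self
      (β := fun i : Fin (n + 1) => consObj P M i.castSucc ⟶ consObj P M i.succ)
      0 y (consChain x f)).symm
  | succ j => exact (Function.update_of_ne (Fin.succ_ne_zero j) _ _).symm

end Cons

namespace HomDeg

variable {k : Type w} [CommRing k]
variable {C : Type u₁} [Category.{v₁} C] [Preadditive C] [CategoryTheory.Linear k C]
variable {D : Type u₂} [Category.{v₂} D] [Preadditive D] [CategoryTheory.Linear k D]
variable {I V : C ⥤ D} {n : ℕ} {P : C} {W : D}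

theorem apply_eq_of_heq {U : C ⥤ D} (φ : HomDeg k U V n) 
    {M M' : Fin (n + 1) → C} (hM : M = M')
    {f : ∀ i : Fin n, M i.castSucc ⟶ M i.succ} {f' : ∀ i : Fin n, M' i.castSucc ⟶ M' i.succ}
    (hf : HEq f f') : HEq (φ M f) (φ M' f') := by
  subst hM
  rw [eq_of_heq hf]

variable (k I) in
/-- The functor `I` is induced from the object `W` along `P`: `I X` is the tensor product of `W`
with the `k`-module `P ⟶ X`, expressed by its universal property, where `ε : W ⟶ I P` is the
element belonging to the identity of `P`. -/
def IsInduced (ε : W ⟶ I.obj P) : Prop :=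
  ∀ (X : C) (E : D) (L : (P ⟶ X) →ₗ[k] (W ⟶ E)),
    ∃! l : I.obj X ⟶ E, ∀ g : P ⟶ X, ε ≫ I.map g ≫ l = L g

variable {ε : W ⟶ I.obj P}

theorem IsInduced.hom_ext (hI : IsInduced k I ε) [I.Additive] [I.Linear k] {X : C} {E : D}
    {l l' : I.obj X ⟶ E} (h : ∀ g : P ⟶ X, ε ≫ I.map g ≫ l = ε ≫ I.map g ≫ l') : l = l' := by
  let L : (P ⟶ X) →ₗ[k] (W ⟶ E) :=
    Linear.leftComp k _ ε ∘ₗ Linear.rightComp k _ l' ∘ₗ I.mapLinearMap k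
  exact (hI X E L).unique h fun g => rfl

/-- Putting `x : P ⟶ M 0` in front of the chain, as a linear function of `x`. -/
noncomputable def consEval (φ : HomDeg k I V (n + 1)) (ε : W ⟶ I.obj P) (M : Fin (n + 1) → C)
    (f : ∀ i : Fin n, M i.castSucc ⟶ M i.succ) :
    (P ⟶ M 0) →ₗ[k] (W ⟶ V.obj (M (Fin.last n))) :=
  Linear.leftComp k (V.obj (M (Fin.last n))) ε ∘ₗ
    (φ (consObj P M)).toLinearMap (consChain 0 f) 0

theorem consEval_apply (φ : HomDeg k I V (n + 1)) (ε : W ⟶ I.obj P) (M : Fin (n + 1) → C)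
    (f : ∀ i : Fin n, M i.castSucc ⟶ M i.succ) (x : P ⟶ M 0) :
    consEval φ ε M f x = ε ≫ φ (consObj P M) (consChain x f) := by
  classical
  rw [consChain_zero_update 0 f x]
  rfl

theorem exists_consEval_update (φ : HomDeg k I V (n + 1)) (ε : W ⟶ I.obj P)
    (M : Fin (n + 1) → C) (f : ∀ i : Fin n, M i.castSucc ⟶ M i.succ) [DecidableEq (Fin n)]
    (i : Fin n) (x : P ⟶ M 0) :
    ∃ L : (M i.castSucc ⟶ M i.succ) →ₗ[k] (W ⟶ V.obj (M (Fin.last n))),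
      ∀ y, consEval φ ε M (Function.update f i y) x = L y := by
  classical
  let L : (M i.castSucc ⟶ M i.succ) →ₗ[k] (I.obj P ⟶ V.obj (M (Fin.last n))) :=
    (φ (consObj P M)).toLinearMap (consChain x f) i.succ
  refine ⟨Linear.leftComp k _ ε ∘ₗ L, fun y => ?_⟩
  rw [consEval_apply, consChain_update]
  rfl

variable [I.Additive] [I.Linear k]

/-- The contraction of the cochains on an induced functor: the value of `contract hI φ` on a chain
`M 0 ⟶ ⋯ ⟶ M n` is determined by the values of `φ` on the chains `P ⟶ M 0 ⟶ ⋯ ⟶ M n`. -/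
noncomputable def contract (hI : IsInduced k I ε) (φ : HomDeg k I V (n + 1)) :
    HomDeg k I V n := fun M =>
  { toFun := fun f => (hI _ _ (consEval φ ε M f)).choose
    map_update_add' := fun f i x y => hI.hom_ext fun g => by
      have e (f) := (hI _ _ (consEval φ ε M f)).choose_spec.1 g
      obtain ⟨L, hL⟩ := exists_consEval_update φ ε M f i g
      rw [Preadditive.comp_add, Preadditive.comp_add, e, e, e, hL, hL, hL, map_add]
    map_update_smul' := fun f i c x => hI.hom_ext fun g => by
      have e (f) := (hI _ _ (consEval φ ε M f)).choose_spec.1 g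
      obtain ⟨L, hL⟩ := exists_consEval_update φ ε M f i g
      rw [Linear.comp_smul, Linear.comp_smul, e, e, hL, hL, map_smul] }

theorem comp_contract (hI : IsInduced k I ε) (φ : HomDeg k I V (n + 1)) (M : Fin (n + 1) → C)
    (f : ∀ i : Fin n, M i.castSucc ⟶ M i.succ) (x : P ⟶ M 0) :
    ε ≫ I.map x ≫ contract hI φ M f = ε ≫ φ (consObj P M) (consChain x f) :=
  ((hI _ _ (consEval φ ε M f)).choose_spec.1 x).trans (consEval_apply φ ε M f x)

theorem contract_add (hI : IsInduced k I ε) (φ ψ : HomDeg k I V (n + 1)) :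
    contract hI (φ + ψ) = contract hI φ + contract hI ψ := by
  funext M
  ext f
  refine hI.hom_ext fun x => ?_
  simp only [comp_contract, Pi.add_apply, add_apply, Preadditive.comp_add]
  exact Preadditive.comp_add ..

theorem contract_smul (hI : IsInduced k I ε) (c : k) (φ : HomDeg k I V (n + 1)) :
    contract hI (c • φ) = c • contract hI φ := by
  funext M
  ext f
  refine hI.hom_ext fun x => ?_
  simp only [comp_contract, Pi.smul_apply, smul_apply, Linear.comp_smul]
  exact Linear.comp_smul ..

variable [V.Additive] [V.Linear k]

theorem contract_pull_consHom (hI : IsInduced k I ε) {m n : ℕ} (g : Fin (m + 1) →o Fin (n + 1))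
    (φ : HomDeg k I V (m + 1)) :
    contract hI (pull (consHom g) φ) = pull g (contract hI φ) := by
  funext M
  ext f
  refine hI.hom_ext fun x => ?_
  rw [comp_contract]
  have e1 : φ (fun j => consObj P M (consHom g j)) (chainRestrict (consChain x f) (consHom g)) =
      φ (consObj P fun j => M (g j))
        (consChain (x ≫ chainComp f (Fin.zero_le (g 0))) (chainRestrict f g)) :=
    eq_of_heq (apply_eq_of_heq φ (consObj_comp_consHom P M g) (chainRestrict_consChain x f g))
  have e2 : I.map (chainComp (consChain x f) (Fin.zero_le (consHom g 0))) = 𝟙 (I.obj P) :=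
    (congrArg (fun y => I.map y) (chainComp_self (consChain x f) 0)).trans (I.map_id P)
  have e3 : chainComp (consChain x f) (Fin.le_last (consHom g (Fin.last (m + 1)))) =
      chainComp f (Fin.le_last (g (Fin.last m))) :=
    chainComp_consChain_succ x f (Fin.le_last (g (Fin.last m)))
  have e4 := comp_contract hI φ (fun j => M (g j)) (chainRestrict f g)
    (x ≫ chainComp f (Fin.zero_le (g 0)))
  calc _ = ε ≫ 𝟙 _ ≫ φ (consObj P fun j => M (g j))
        (consChain (x ≫ chainComp f (Fin.zero_le (g 0))) (chainRestrict f g)) ≫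
        V.map (chainComp f (Fin.le_last (g (Fin.last m)))) := by
        rw [pull_apply]
        exact congrArg (ε ≫ ·) (congrArg₂ (· ≫ ·) e2 (congrArg₂ (· ≫ ·) e1 (congrArg (V.map ·) e3)))
    _ = (ε ≫ φ (consObj P fun j => M (g j))
        (consChain (x ≫ chainComp f (Fin.zero_le (g 0))) (chainRestrict f g))) ≫
        V.map (chainComp f (Fin.le_last (g (Fin.last m)))) := by
        rw [Category.id_comp]
        exact (Category.assoc ..).symm
    _ = _ := by
        have assoc {X₁ X₂ X₃ X₄ X₅ X₆ : D} (a : X₁ ⟶ X₂) (b : X₂ ⟶ X₃) (c : X₃ ⟶ X₄)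
            (d : X₄ ⟶ X₅) (e : X₅ ⟶ X₆) : (a ≫ (b ≫ c) ≫ d) ≫ e = a ≫ b ≫ c ≫ d ≫ e := by
          simp only [Category.assoc]
        rw [← e4, pull_apply, I.map_comp]
        exact assoc ..

theorem contract_pull_zero (hI : IsInduced k I ε) (φ : HomDeg k I V n) :
    contract hI (pull (Fin.succAboveOrderEmb 0).toOrderHom φ) = φ := by
  funext M
  ext f
  refine hI.hom_ext fun x => ?_
  rw [comp_contract]
  have e1 : chainComp (consChain x f) (Fin.zero_le (0 : Fin (n + 1)).succ) = x :=
    chainComp_succ (consChain x f) 0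
  have e2 : chainRestrict (consChain x f) (Fin.succAboveOrderEmb 0).toOrderHom = f := by
    funext j
    exact chainComp_succ (consChain x f) j.succ
  have e3 : chainComp (consChain x f) (Fin.le_last (Fin.last n).succ) = 𝟙 (M (Fin.last n)) :=
    chainComp_self (consChain x f) (Fin.last (n + 1))
  calc _ = ε ≫ I.map x ≫ φ M f ≫ 𝟙 _ := by
        rw [pull_apply]
        exact congrArg (ε ≫ ·) (congrArg₂ (· ≫ ·) (congrArg (I.map ·) e1)
          (congrArg₂ (· ≫ ·) (congrArg (φ M ·) e2) ((congrArg (V.map ·) e3).trans (V.map_id _))))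
    _ = _ := by rw [Category.comp_id]

/-- The first face of a cochain is undone by the contraction `s`, and the other faces commute with
`s`; so up to sign `s ∘ δ = id ± δ ∘ s` in positive degrees. -/
theorem vanishesAbove_of_isInduced (hI : IsInduced k I ε) : VanishesAbove k I V 0 := by
  intro n _ φ hφ
  let s : HomDeg k I V (n + 2) →ₗ[k] HomDeg k I V (n + 1) :=
    { toFun := contract hI, map_add' := contract_add hI, map_smul' := contract_smul hI }
  let s' : HomDeg k I V (n + 1) →ₗ[k] HomDeg k I V n :=
    { toFun := contract hI, map_add' := contract_add hI, map_smul' := contract_smul hI }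
  have h0 (i : Fin (n + 2)) : s (pull (Fin.succAboveOrderEmb i.succ).toOrderHom φ) =
      pull (Fin.succAboveOrderEmb i).toOrderHom (s' φ) := by
    rw [succAboveOrderEmb_succ_toOrderHom]
    exact contract_pull_consHom hI _ φ
  have h1 : s (pull (Fin.succAboveOrderEmb 0).toOrderHom φ) = φ := contract_pull_zero hI φ
  have h2 := congrArg s hφ
  rw [differential_eq, map_smul, map_sum, Fin.sum_univ_succ, map_zero] at h2
  refine ⟨(-1 : k) ^ (n + 1) • s' φ, ?_⟩
  rw [map_smul, differential_eq, smul_smul, ← mul_pow, neg_one_mul, neg_neg, one_pow, one_smul]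
  have h3 := congrArg (fun x => (-1 : k) ^ (n + 2) • x) h2
  simp only [smul_smul, ← mul_pow, neg_neg, one_pow, one_smul, smul_zero,
    h1, Fin.val_zero, pow_zero, Fin.val_succ, pow_succ, mul_neg_one, neg_smul, map_neg, map_smul,
    h0, Finset.sum_neg_distrib] at h3
  exact (add_neg_eq_zero.1 h3).symm

end HomDeg

/-! ### Koszul sequences of tensor products -/

open TensorProduct

/-- The monomials in algebraically independent generators form a basis. -/
noncomputable def AlgebraicIndependent.monomialBasis {ι S A : Type*} [CommRing S] [CommRing A]
    [Algebra S A] {y : ι → A} (hy : AlgebraicIndependent S y)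
    (h : Algebra.adjoin S (Set.range y) = ⊤) : Module.Basis (ι →₀ ℕ) S A :=
  (MvPolynomial.basisMonomials ι S).map (AlgEquiv.ofBijective (MvPolynomial.aeval y)
    ⟨hy, by rw [← AlgHom.range_eq_top, ← Algebra.adjoin_range_eq_range_aeval, h]⟩).toLinearEquiv

theorem AlgebraicIndependent.monomialBasis_apply {ι S A : Type*} [CommRing S] [CommRing A]
    [Algebra S A] {y : ι → A} (hy : AlgebraicIndependent S y)
    (h : Algebra.adjoin S (Set.range y) = ⊤) (m : ι →₀ ℕ) :
    hy.monomialBasis h m = m.prod fun i e => y i ^ e := by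
  change MvPolynomial.aeval y (MvPolynomial.basisMonomials ι S m) = _
  simp [MvPolynomial.aeval_monomial]

theorem AlgebraicIndependent.mul_monomialBasis {ι S A : Type*} [CommRing S] [CommRing A]
    [Algebra S A] {y : ι → A} (hy : AlgebraicIndependent S y)
    (h : Algebra.adjoin S (Set.range y) = ⊤) (i : ι) (m : ι →₀ ℕ) :
    y i * hy.monomialBasis h m = hy.monomialBasis h (m + Finsupp.single i 1) := by
  rw [monomialBasis_apply, monomialBasis_apply, Finsupp.prod_add_index' (by simp)
    (by intros; rw [pow_add]), Finsupp.prod_single_index (by simp), pow_one, mul_comm]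

namespace MvPolynomial
variable {σ k : Type*} [Field k]

theorem algebraicIndependent_X_compl (s : Set σ) :
    AlgebraicIndependent (supported k s) fun i : (sᶜ : Set σ) => (X (i : σ) : MvPolynomial σ k) :=
  ((AlgebraicIndependent.iff_adjoin_image s).1 (algebraicIndependent_X σ k)).2

theorem adjoin_X_compl (s : Set σ) :
    Algebra.adjoin (supported k s)
      (Set.range fun i : (sᶜ : Set σ) => (X (i : σ) : MvPolynomial σ k)) = ⊤ := by
  set A := Algebra.adjoin (supported k s)
      (Set.range fun i : (sᶜ : Set σ) => (X (i : σ) : MvPolynomial σ k))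
  rw [eq_top_iff]
  intro p _
  induction p using MvPolynomial.induction_on with
  | C a => exact A.algebraMap_mem (algebraMap k (supported k s) a)
  | add p q hp hq => exact A.add_mem (hp trivial) (hq trivial)
  | mul_X p i hp =>
    refine A.mul_mem (hp trivial) ?_
    by_cases hi : i ∈ s
    · exact A.algebraMap_mem (⟨X i, X_mem_supported.2 hi⟩ : supported k s)
    · exact Algebra.subset_adjoin ⟨⟨i, hi⟩, rfl⟩

variable (k) in
/-- The polynomial ring is free over the polynomials in the variables `s`: the monomials in the
remaining variables form a basis. -/
noncomputable def complMonomialBasis (s : Set σ) :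
    Module.Basis ((sᶜ : Set σ) →₀ ℕ) (supported k s) (MvPolynomial σ k) :=
  (algebraicIndependent_X_compl s).monomialBasis (adjoin_X_compl s)

theorem X_mul_complMonomialBasis (s : Set σ) (i : (sᶜ : Set σ)) (m : (sᶜ : Set σ) →₀ ℕ) :
    X (i : σ) * complMonomialBasis k s m = complMonomialBasis k s (m + Finsupp.single i 1) := by
  unfold complMonomialBasis
  exact AlgebraicIndependent.mul_monomialBasis _ _ i m

end MvPolynomial

namespace TensorProduct

section Balanced

variable {S R' N Z T : Type*} [CommRing S] [CommRing R'] [AddCommGroup N] [Module S N]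
  [Module R' N] [SMulCommClass S R' N] [AddCommGroup Z] [Module S Z] [AddCommGroup T] [Module R' T]

variable (S R' N) in
/-- The map `n ↦ n ⊗ z`, linear over a ring `R'` acting on the left factor only. -/
def tmulLeft (z : Z) : N →ₗ[R'] N ⊗[S] Z where
  toFun n := n ⊗ₜ z
  map_add' _ _ := add_tmul ..
  map_smul' _ _ := (smul_tmul' ..).symm

@[simp]
theorem tmulLeft_apply (z : Z) (n : N) : tmulLeft S R' N z n = n ⊗ₜ[S] z :=
  rfl

theorem hom_ext_tmul {f g : N ⊗[S] Z →ₗ[R'] T} (h : ∀ n z, f (n ⊗ₜ z) = g (n ⊗ₜ z)) :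
    f = g := by
  ext t
  induction t with
  | zero => simp
  | tmul n z => exact h n z
  | add a b ha hb => rw [map_add, map_add, ha, hb]

/-- The map out of a tensor product given by a balanced biadditive map, linear over a ring `R'` that
acts on the left factor only; `S` need not act on the target. -/
def balancedLift (f : Z →+ N →ₗ[R'] T) (hf : ∀ (s : S) z n, f (s • z) n = f z (s • n)) :
    N ⊗[S] Z →ₗ[R'] T where
  toFun := liftAddHom
    (AddMonoidHom.flip ((LinearMap.toAddMonoidHom' : (N →ₗ[R'] T) →+ _).comp f))
    fun s n z => (hf s z n).symm
  map_add' := map_add _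
  map_smul' c t := by
    induction t with
    | zero => simp
    | tmul n z => exact (f z).map_smul c n
    | add a b ha hb => rw [smul_add, map_add, map_add, smul_add, ha, hb]

/-- The tensor product with a free module is a direct sum of copies of `N`. -/
theorem projective_of_basis_right {κ : Type*} (b : Module.Basis κ S Z) [Module.Projective R' N] :
    Module.Projective R' (N ⊗[S] Z) := by
  classical
  let e : N ⊗[S] Z ≃+ (κ →₀ N) := (equivFinsuppOfBasisRight b).toAddEquiv
  have he (c : R') (t : N ⊗[S] Z) : e (c • t) = c • e t := by
    induction t with
    | zero => simp
    | tmul n z =>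
      ext i
      change equivFinsuppOfBasisRight b ((c • n) ⊗ₜ z) i =
        c • equivFinsuppOfBasisRight b (n ⊗ₜ z) i
      rw [equivFinsuppOfBasisRight_apply_tmul_apply, equivFinsuppOfBasisRight_apply_tmul_apply,
        smul_comm]
    | add x y hx hy => rw [smul_add, map_add, map_add, smul_add, hx, hy]
  have : Module.Projective R' (Π₀ _ : κ, N) := inferInstance
  let e' : N ⊗[S] Z ≃ₗ[R'] (κ →₀ N) := { e with map_smul' := he }
  exact Module.Projective.of_equiv' ((finsuppLequivDFinsupp R').symm ≪≫ₗ e'.symm)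

end Balanced

section Koszul

variable {S R R' N Z : Type*} [CommRing S] [CommRing R] [Algebra S R] [CommRing R']
  [AddCommGroup N] [Module S N] [Module R N] [IsScalarTower S R N] [Module R' N]
  [SMulCommClass S R' N] [SMulCommClass R R' N]
  [AddCommGroup Z] [Module S Z] [Module R Z] [IsScalarTower S R Z]

variable (S R' N Z) in
/-- The map `n ⊗ z ↦ x n ⊗ z - n ⊗ x z`, whose cokernel forces the two actions of `x` to agree. -/
def actionDiff (x : R) : N ⊗[S] Z →ₗ[R'] N ⊗[S] Z :=
  balancedLift
    { toFun := fun z =>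
        (tmulLeft S R' N z).comp (DistribSMul.toLinearMap R' N x) - tmulLeft S R' N (x • z)
      map_zero' := by
        ext n
        simp
      map_add' := fun z z' => by
        ext n
        simp only [LinearMap.sub_apply, LinearMap.comp_apply, LinearMap.add_apply, tmulLeft_apply,
          smul_add, tmul_add]
        abel }
    fun s z n => by
      simp [smul_tmul, smul_comm x s]

@[simp]
theorem actionDiff_tmul (x : R) (n : N) (z : Z) :
    actionDiff S R' N Z x (n ⊗ₜ z) = (x • n) ⊗ₜ z - n ⊗ₜ (x • z) :=
  rfl

/-- If `x` maps the members of an `S`-basis of `Z` injectively to members of higher degree, then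
the terms of highest degree show that `actionDiff` is injective. -/
theorem actionDiff_injective {κ : Type*} (b : Module.Basis κ S Z) (x : R) (τ : κ → κ)
    (hτ : Function.Injective τ) (deg : κ → ℕ) (hdeg : ∀ i, deg i < deg (τ i))
    (hx : ∀ i, x • b i = b (τ i)) : Function.Injective (actionDiff S R' N Z x) := by
  classical
  let e := equivFinsuppOfBasisRight (M := N) b
  -- In coordinates the coefficient at `τ i` of the image only involves those at `τ i` and `i`.
  have key (t : N ⊗[S] Z) (i : κ) :
      e (actionDiff S R' N Z x t) (τ i) = x • e t (τ i) - e t i := by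
    obtain ⟨a, rfl⟩ := e.symm.surjective t
    induction a using Finsupp.induction_linear with
    | zero => simp
    | add a a' ha ha' =>
      simp only [map_add, Finsupp.add_apply, smul_add, ha, ha']
      abel
    | single j n =>
      have h1 : e.symm (Finsupp.single j n) = n ⊗ₜ b j := by simp [e]
      have h2 (j : κ) (n : N) : e (n ⊗ₜ b j) = Finsupp.single j n := by
        ext l
        simp only [e, equivFinsuppOfBasisRight_apply_tmul_apply, Module.Basis.repr_self,
          Finsupp.single_apply]
        split_ifs <;> simp
      rw [h1, actionDiff_tmul, hx, map_sub, h2, h2, h2]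
      simp only [Finsupp.sub_apply, Finsupp.single_apply, hτ.eq_iff]
      split_ifs <;> simp
  refine (injective_iff_map_eq_zero _).2 fun t ht => ?_
  by_contra h0
  have hne : (e t).support.Nonempty := by
    rw [Finsupp.support_nonempty_iff]
    simpa using h0
  obtain ⟨i, hi, hmax⟩ := (e t).support.exists_max_image deg hne
  have h1 : e t (τ i) = 0 := by
    by_contra h
    exact (hmax _ (Finsupp.mem_support_iff.2 h)).not_gt (hdeg i)
  have h2 := key t i
  rw [ht, h1] at h2
  simp only [map_zero, Finsupp.coe_zero, Pi.zero_apply, smul_zero, zero_sub] at h2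
  exact Finsupp.mem_support_iff.1 hi (neg_eq_zero.1 h2.symm)

end Koszul

section Enlarge

variable {k R R' N Z : Type*} [Field k] [CommRing R] [Algebra k R] [CommRing R']
  [AddCommGroup N] [Module R N] [Module R' N] [SMulCommClass R R' N] [AddCommGroup Z] [Module R Z]

variable (R' N Z) in
/-- The canonical surjection from the tensor product over `S` to that over a larger ring `S'`. -/
def enlarge {S S' : Subalgebra k R} (h : S ≤ S') : N ⊗[S] Z →ₗ[R'] N ⊗[S'] Z :=
  balancedLift
    { toFun := fun z => tmulLeft S' R' N z
      map_zero' := by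
        ext n
        simp
      map_add' := fun z z' => by
        ext n
        simp [tmul_add] }
    fun s z n => ((smul_tmul (⟨s, h s.2⟩ : S') n z)).symm

theorem enlarge_surjective {S S' : Subalgebra k R} (h : S ≤ S') :
    Function.Surjective (enlarge R' N Z h) := by
  intro t
  induction t with
  | zero => exact ⟨0, map_zero _⟩
  | tmul n z => exact ⟨n ⊗ₜ z, rfl⟩
  | add a b ha hb =>
    obtain ⟨a, rfl⟩ := ha
    obtain ⟨b, rfl⟩ := hb
    exact ⟨a + b, map_add ..⟩

/-- If `S'` is generated by `S` and `x`, then `N ⊗[S'] Z` is the quotient of `N ⊗[S] Z` which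
identifies the two actions of `x`. -/
theorem exact_actionDiff_enlarge {S S' : Subalgebra k R} (h : S ≤ S') (x : R) (hx : x ∈ S')
    (hS' : S' ≤ S ⊔ Algebra.adjoin k {x}) :
    Function.Exact (actionDiff S R' N Z x) (enlarge R' N Z h) := by
  let A := LinearMap.range (actionDiff S R' N Z x)
  -- The elements whose two actions agree modulo the range form a subalgebra.
  let T : Subalgebra k R :=
    { carrier := {t | ∀ (n : N) (z : Z), (t • n) ⊗ₜ[S] z - n ⊗ₜ[S] (t • z) ∈ A}
      mul_mem' := fun {s t} hs ht n z => by
        have := A.add_mem (hs (t • n) z) (ht n (s • z))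
        rwa [sub_add_sub_cancel, smul_smul, smul_smul, mul_comm t s] at this
      add_mem' := fun {s t} hs ht n z => by
        have := A.add_mem (hs n z) (ht n z)
        rw [add_smul, add_smul, add_tmul, tmul_add]
        convert this using 1
        abel
      algebraMap_mem' := fun c n z => by
        have : (algebraMap k R c • n) ⊗ₜ[S] z = n ⊗ₜ[S] (algebraMap k R c • z) :=
          smul_tmul (algebraMap k S c) n z
        rw [this, sub_self]
        exact A.zero_mem }
  have hT : S' ≤ T := by
    refine hS'.trans (sup_le (fun s hs n z => ?_) (Algebra.adjoin_le ?_))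
    · have : (s • n) ⊗ₜ[S] z = n ⊗ₜ[S] (s • z) := smul_tmul (⟨s, hs⟩ : S) n z
      rw [this, sub_self]
      exact A.zero_mem
    · rintro _ rfl n z
      exact ⟨n ⊗ₜ z, actionDiff_tmul ..⟩
  let q : N ⊗[S'] Z →ₗ[R'] (N ⊗[S] Z) ⧸ A :=
    balancedLift
      { toFun := fun z => A.mkQ.comp (tmulLeft S R' N z)
        map_zero' := by
          ext n
          simp
        map_add' := fun z z' => by
          ext n
          simp [tmul_add] }
      fun s z n => by
        refine ((Submodule.Quotient.eq A).2 ?_).symm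
        exact hT s.2 n z
  have hq : q.comp (enlarge R' N Z h) = A.mkQ := hom_ext_tmul fun n z => rfl
  have h0 : (enlarge R' N Z h).comp (actionDiff S R' N Z x) = 0 := hom_ext_tmul fun n z => by
    change (x • n) ⊗ₜ[S'] z - n ⊗ₜ[S'] (x • z) = 0
    rw [sub_eq_zero]
    exact smul_tmul (⟨x, hx⟩ : S') n z
  intro t
  refine ⟨fun ht => ?_, ?_⟩
  · have := congrArg (fun f => f t) hq
    simp only [LinearMap.comp_apply, ht, map_zero] at this
    exact (Submodule.Quotient.mk_eq_zero A).1 this.symm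
  · rintro ⟨t, rfl⟩
    exact congrArg (fun f => f t) h0

end Enlarge

end TensorProduct

/-! ### Tensor functors on free modules and their cohomology -/

namespace FreeFinMod

section Basic

variable {k R : Type} [Field k] [CommRing R] [Algebra k R]

variable (R) in
/-- The free module of rank one, in the universe of the given category of modules. -/
def unit : FreeFinMod.{u} R :=
  ⟨ModuleCat.of R (ULift.{u} R), inferInstance, inferInstance⟩

/-- The morphism from the free module of rank one with `1 ↦ z`. -/
def toHom {X : FreeFinMod.{u} R} (z : X.obj) : unit R ⟶ X :=
  ObjectProperty.homMk
    (ModuleCat.ofHom ((LinearMap.toSpanSingleton R X.obj z).comp ULift.moduleEquiv.toLinearMap))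

theorem hom_ext {X Y : FreeFinMod.{u} R} {f g : X ⟶ Y}
    (h : ∀ z : X.obj, f.hom.hom z = g.hom.hom z) : f = g :=
  ObjectProperty.hom_ext _ (ModuleCat.hom_ext (LinearMap.ext h))

theorem toHom_comp {X Y : FreeFinMod.{u} R} (z : X.obj) (f : X ⟶ Y) :
    toHom z ≫ f = toHom (f.hom.hom z) :=
  hom_ext fun r => f.hom.hom.map_smul r.down z

theorem toHom_hom_one {X : FreeFinMod.{u} R} (f : unit R ⟶ X) :
    toHom (f.hom.hom (ULift.up 1 : ULift.{u} R)) = f :=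
  hom_ext fun r => by
    have h : r = (r.down • (ULift.up 1 : ULift.{u} R) : ULift.{u} R) :=
      ULift.ext _ _ (mul_one _).symm
    exact (f.hom.hom.map_smul r.down (ULift.up 1 : ULift.{u} R)).symm.trans
      (congrArg f.hom.hom h.symm)

theorem toHom_add {X : FreeFinMod.{u} R} (z z' : X.obj) : toHom (z + z') = toHom z + toHom z' :=
  hom_ext fun r => smul_add r.down z z'

theorem toHom_algebraMap_smul {X : FreeFinMod.{u} R} (c : k) (z : X.obj) :
    toHom (algebraMap k R c • z) = c • toHom z :=
  hom_ext fun r => smul_comm r.down (algebraMap k R c) z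

end Basic

section TensorFunctor

variable {k R R' : Type} [Field k] [CommRing R] [Algebra k R] [CommRing R']
  (S : Subalgebra k R) (N : Type (max u v)) [AddCommGroup N] [Module R N] [Module R' N]
  [SMulCommClass R R' N]

variable (R') in
/-- The functor `X ↦ N ⊗[S] X`, where `R'` acts on `N`, and the functoriality in `X` uses
the whole ring `R`. -/
noncomputable def tensorFunctor : FreeFinMod.{u} R ⥤ ModuleCat.{max u v} R' where
  obj X := ModuleCat.of R' (N ⊗[S] X.obj)
  map {X Y} f := ModuleCat.ofHom (balancedLift
    { toFun := fun z => tmulLeft S R' N (f.hom.hom z)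
      map_zero' := by
        ext n
        simp
      map_add' := fun z z' => by
        ext n
        simp [tmul_add] }
    fun s z n => by
      have : f.hom.hom (s • z) = s • f.hom.hom z := f.hom.hom.map_smul (s : R) z
      simp [this, smul_tmul])
  map_id X := by
    ext : 1
    exact hom_ext_tmul fun n z => rfl
  map_comp f g := by
    ext : 1
    exact hom_ext_tmul fun n z => rfl

instance : (tensorFunctor.{u, v} R' S N).Additive where
  map_add {X Y f g} := by
    ext : 1
    exact hom_ext_tmul fun n z => tmul_add n (f.hom.hom z) (g.hom.hom z)

/-- The endomorphism `n ⊗ z ↦ x n ⊗ z - n ⊗ x z` of the functor `X ↦ N ⊗[S] X`. -/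
noncomputable def actionDiffTrans (x : R) :
    tensorFunctor.{u, v} R' S N ⟶ tensorFunctor.{u, v} R' S N where
  app X := ModuleCat.ofHom (actionDiff S R' N X.obj x)
  naturality X Y f := by
    ext : 1
    refine hom_ext_tmul fun n z => ?_
    refine Eq.trans ?_ (map_sub ((tensorFunctor.{u, v} R' S N).map f).hom ((x • n) ⊗ₜ[S] z)
      (n ⊗ₜ[S] (x • z))).symm
    change (x • n) ⊗ₜ[S] (f.hom.hom z) - n ⊗ₜ[S] (x • f.hom.hom z) =
      (x • n) ⊗ₜ[S] (f.hom.hom z) - n ⊗ₜ[S] (f.hom.hom (x • z))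
    rw [map_smul]

variable {S} in
/-- The projection `N ⊗[S] X ⟶ N ⊗[S'] X`, natural in `X`. -/
noncomputable def enlargeTrans {S' : Subalgebra k R} (h : S ≤ S') :
    tensorFunctor.{u, v} R' S N ⟶ tensorFunctor.{u, v} R' S' N where
  app X := ModuleCat.ofHom (enlarge R' N X.obj h)
  naturality X Y f := by
    ext : 1
    exact hom_ext_tmul fun n z => rfl

variable [Algebra k R']

theorem tensorFunctor_linear
    (hk : ∀ (c : k) (n : N), algebraMap k R c • n = algebraMap k R' c • n) :
    (tensorFunctor.{u, v} R' S N).Linear k where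
  map_smul {X Y} f c := by
    ext : 1
    refine hom_ext_tmul fun n z => ?_
    change n ⊗ₜ[S] (algebraMap k R c • f.hom.hom z) =
      algebraMap k R' c • (n ⊗ₜ[S] f.hom.hom z)
    rw [smul_tmul', ← hk]
    exact (smul_tmul (algebraMap k S c) n _).symm

/-- Over the ground field the functor `X ↦ N ⊗ X` is induced from `N`, with `n ↦ n ⊗ 1` as the
universal element. -/
theorem isInduced_tensorFunctor_bot
    (hk : ∀ (c : k) (n : N), algebraMap k R c • n = algebraMap k R' c • n) :
    HomDeg.IsInduced k (tensorFunctor.{u, v} R' (⊥ : Subalgebra k R) N) (P := unit R)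
      (ModuleCat.ofHom (tmulLeft (⊥ : Subalgebra k R) R' N (ULift.up 1 : ULift.{u} R))) := by
  intro X E L
  refine ⟨ModuleCat.ofHom (balancedLift
    { toFun := fun z => (L (toHom z)).hom
      map_zero' := by
        have : toHom (0 : X.obj) = 0 := hom_ext fun r => smul_zero r.down
        rw [this, map_zero]
        rfl
      map_add' := fun z z' => by
        rw [toHom_add, map_add]
        rfl } ?_), ?_, ?_⟩
  · rintro ⟨_, hs⟩ z n
    obtain ⟨c, rfl⟩ := Algebra.mem_bot.1 hs
    change (L (toHom (algebraMap k R c • z))).hom n = (L (toHom z)).hom (algebraMap k R c • n)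
    rw [toHom_algebraMap_smul, map_smul, hk, map_smul]
    rfl
  · intro g
    ext n
    change (L (toHom (g.hom.hom _))).hom n = (L g).hom n
    rw [toHom_hom_one]
  · intro l hl
    ext : 1
    refine hom_ext_tmul fun n z => ?_
    have := congrArg (fun h => h.hom n) (hl (toHom z))
    refine Eq.trans ?_ this
    change l.hom (n ⊗ₜ z) = l.hom (n ⊗ₜ ((1 : R) • z))
    rw [one_smul]

end TensorFunctor

section Vanishing

variable {k R' σ : Type} [Field k] [CommRing R']

open MvPolynomial

/-- A basis of a free module over the polynomials in the variables `s`: products of monomials in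
the remaining variables with the members of a basis over all polynomials. -/
noncomputable def supportedBasis {ι Z : Type*} [AddCommGroup Z] [Module (MvPolynomial σ k) Z]
    (s : Set σ) (b : Module.Basis ι (MvPolynomial σ k) Z) :
    Module.Basis (((sᶜ : Set σ) →₀ ℕ) × ι) (supported k s) Z :=
  (complMonomialBasis k s).smulTower b

/-- Multiplication by the variable `x_i` raises the exponent of `x_i` in the members of
`supportedBasis s b` by one. -/
theorem actionDiff_X_injective {ι N Z : Type*} [AddCommGroup N]
    [Module (MvPolynomial σ k) N] [Module R' N] [SMulCommClass (MvPolynomial σ k) R' N]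
    [AddCommGroup Z] [Module (MvPolynomial σ k) Z]
    (b : Module.Basis ι (MvPolynomial σ k) Z) (s : Set σ) (i : σ) (hi : i ∉ s) :
    Function.Injective
      (actionDiff (supported k s) R' N Z (MvPolynomial.X i : MvPolynomial σ k)) := by
  let i' : (sᶜ : Set σ) := ⟨i, hi⟩
  refine actionDiff_injective (supportedBasis s b) _
    (fun p => (p.1 + Finsupp.single i' 1, p.2)) (fun p q h => ?_)
    (fun p => p.1 i') (fun p => by simp) fun p => ?_
  · simp only [Prod.mk.injEq, add_left_inj] at h
    exact Prod.ext h.1 h.2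
  · rw [supportedBasis, Module.Basis.smulTower_apply, Module.Basis.smulTower_apply, smul_smul]
    congr 1
    exact X_mul_complMonomialBasis s i' p.1

/-- Adjoining the variables `s` one after the other raises the bound by one each time, by the
Koszul sequences of the individual variables. -/
theorem vanishesAbove_tensorFunctor [Algebra k R']
    {N : Type (max u v)} [AddCommGroup N] [Module (MvPolynomial σ k) N] [Module R' N]
    [SMulCommClass (MvPolynomial σ k) R' N] [Module.Projective R' N]
    (hk : ∀ (c : k) (n : N), algebraMap k (MvPolynomial σ k) c • n = algebraMap k R' c • n)
    (V : FreeFinMod.{u} (MvPolynomial σ k) ⥤ ModuleCat.{max u v} R') [V.Additive] [V.Linear k]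
    (s : Finset σ) :
    haveI := tensorFunctor_linear.{u, v} (R' := R') (supported k (s : Set σ)) N hk
    HomDeg.VanishesAbove k (tensorFunctor.{u, v} R' (supported k (s : Set σ)) N) V s.card := by
  classical
  have this (S) := tensorFunctor_linear.{u, v} (R' := R') S N hk
  induction s using Finset.induction_on with
  | empty =>
    rw [Finset.card_empty]
    have e : supported k ((∅ : Finset σ) : Set σ) = ⊥ := by
      rw [Finset.coe_empty, supported_empty]
    rw [e]
    exact HomDeg.vanishesAbove_of_isInduced (isInduced_tensorFunctor_bot.{u, v} N hk)
  | insert i s hi ih =>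
    rw [Finset.card_insert_of_notMem hi]
    have hle : supported k (s : Set σ) ≤ supported k ((insert i s : Finset σ) : Set σ) :=
      supported_mono (by simp)
    have hex (X : FreeFinMod.{u} (MvPolynomial σ k)) :
        Function.Exact (actionDiff (supported k (s : Set σ)) R' N X.obj
          (MvPolynomial.X i : MvPolynomial σ k)) (enlarge R' N X.obj hle) := by
      refine exact_actionDiff_enlarge hle _ (X_mem_supported.2 (by simp)) ?_
      rw [supported_eq_adjoin_X, supported_eq_adjoin_X, ← Algebra.adjoin_union]
      apply Algebra.adjoin_mono
      rintro _ ⟨j, hj, rfl⟩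
      rcases Finset.mem_insert.1 (Finset.mem_coe.1 hj) with rfl | hj
      · exact Or.inr rfl
      · exact Or.inl ⟨j, hj, rfl⟩
    -- The cokernel is projective over `R'`, which splits the sequence for each `X`; the splittings
    -- are not natural in `X`.
    let T (X : FreeFinMod.{u} (MvPolynomial σ k)) : ShortComplex (ModuleCat.{max u v} R') :=
      ShortComplex.mk ((actionDiffTrans.{u, v} (R' := R') (supported k (s : Set σ)) N
          (MvPolynomial.X i : MvPolynomial σ k)).app X)
        ((enlargeTrans.{u, v} (R' := R') N hle).app X) (by
          ext : 1
          exact (hex X).linearMap_comp_eq_zero)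
    have hT (X) : (T X).ShortExact :=
      { exact := (ShortComplex.ShortExact.moduleCat_exact_iff_function_exact _).2 (hex X)
        mono_f := (ModuleCat.mono_iff_injective _).2
          (haveI := X.property.1
          actionDiff_X_injective (Module.Free.chooseBasis (MvPolynomial σ k) X.obj) (s : Set σ) i
            (by simpa using hi))
        epi_g := (ModuleCat.epi_iff_surjective _).2 (enlarge_surjective hle) }
    have hP (X) : Projective (T X).X₃ :=
      haveI := X.property.1
      (IsProjective.iff_projective _).1 (projective_of_basis_right
        (supportedBasis _ (Module.Free.chooseBasis (MvPolynomial σ k) X.obj)))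
    let spl (X) := (hT X).splittingOfProjective
    exact HomDeg.VanishesAbove.of_shortExact
      (actionDiffTrans.{u, v} (R' := R') (supported k (s : Set σ)) N
        (MvPolynomial.X i : MvPolynomial σ k)) (enlargeTrans.{u, v} (R' := R') N hle)
      (fun X => (spl X).r) (fun X => (spl X).s) (fun X => (T X).zero) (fun X => (spl X).f_r)
      (fun X => (spl X).s_g) (fun X => (spl X).id) ih ih

end Vanishing

end FreeFinMod

/-! ### Every functor is a tensor functor -/

namespace FreeFinMod

section UnitValue

variable {k R R' : Type} [Field k] [CommRing R] [Algebra k R] [CommRing R']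

/-- Multiplication by a ring element on the free module of rank one. -/
def scalar (r : R) : unit.{u} R ⟶ unit R :=
  ObjectProperty.homMk (ModuleCat.ofHom (r • LinearMap.id))

theorem toHom_smul {X : FreeFinMod.{u} R} (r : R) (z : X.obj) :
    toHom (r • z) = scalar r ≫ toHom z :=
  hom_ext fun s => by
    change s.down • r • z = (r * s.down) • z
    rw [smul_smul, mul_comm]

variable (U : FreeFinMod.{u} R ⥤ ModuleCat.{max u v} R') [U.Additive]

/-- The action of `R` on the value of an additive functor at the free module of rank one. -/
def actionHom : R →+* Module.End R' (U.obj (unit R)) where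
  toFun r := (U.map (scalar r)).hom
  map_one' := by
    have : scalar (1 : R) = 𝟙 (unit.{u} R) := hom_ext fun r => one_smul R r
    rw [this, U.map_id]
    rfl
  map_mul' r s := by
    have : scalar (r * s) = scalar.{u} s ≫ scalar r := hom_ext fun t => mul_smul r s t
    rw [this, U.map_comp]
    rfl
  map_zero' := by
    have : scalar (0 : R) = (0 : unit.{u} R ⟶ unit R) := hom_ext fun r => zero_smul R r
    rw [this, U.map_zero]
    rfl
  map_add' r s := by
    have : scalar (r + s) = scalar.{u} r + scalar s := hom_ext fun t => add_smul r s t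
    rw [this, U.map_add]
    rfl

/-- The `R`-module structure on the value of an additive functor at the free module of rank one. -/
@[reducible]
def unitModule : Module R (U.obj (unit R)) :=
  Module.compHom _ (actionHom U)

attribute [local instance] unitModule

theorem unitModule_smul (r : R) (n : U.obj (unit R)) : r • n = (U.map (scalar r)).hom n :=
  rfl

instance : SMulCommClass R R' (U.obj (unit R)) :=
  ⟨fun r c n => ((U.map (scalar r)).hom.map_smul c n)⟩

theorem algebraMap_unitModule_smul [Algebra k R'] [U.Linear k] (c : k) (n : U.obj (unit R)) :
    algebraMap k R c • n = algebraMap k R' c • n := by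
  have : scalar (algebraMap k R c) = c • 𝟙 (unit.{u} R) := hom_ext fun t => rfl
  rw [unitModule_smul, this, U.map_smul, U.map_id]
  rfl

/-- The natural map `U R ⊗[S] X ⟶ U X`, which sends `n ⊗ z` to the image of `n` under `U` of the
morphism `1 ↦ z`. -/
noncomputable def evalTrans (S : Subalgebra k R) :
    tensorFunctor.{u, v} R' S (U.obj (unit R)) ⟶ U where
  app X := ModuleCat.ofHom (balancedLift
    { toFun := fun z => (U.map (toHom z)).hom
      map_zero' := by
        have : toHom (0 : X.obj) = 0 := hom_ext fun r => smul_zero r.down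
        rw [this, U.map_zero]
        rfl
      map_add' := fun z z' => by
        rw [toHom_add, U.map_add]
        rfl }
    fun s z n => by
      have : toHom (s • z) = scalar (s : R) ≫ toHom z := toHom_smul (s : R) z
      change (U.map (toHom (s • z))).hom n = (U.map (toHom z)).hom ((s : R) • n)
      rw [this, U.map_comp]
      rfl)
  naturality X Y f := by
    ext : 1
    refine hom_ext_tmul fun n z => ?_
    change (U.map (toHom (f.hom.hom z))).hom n = (U.map f).hom ((U.map (toHom z)).hom n)
    rw [← toHom_comp, U.map_comp]
    rfl

/-- Over the whole ring `R` the natural map is bijective: both sides are additive in `X`,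
and `X` is a finite direct sum of copies of `R`. -/
theorem evalTrans_app_bijective (S : Subalgebra k R) (hS : S = ⊤) (X : FreeFinMod.{u} R) :
    Function.Bijective ((evalTrans U S).app X).hom := by
  have := X.property.1
  have := X.property.2
  let b := Module.Free.chooseBasis R X.obj
  let p (i) : X ⟶ unit R := ObjectProperty.homMk (ModuleCat.ofHom
    (ULift.moduleEquiv.{0, 0, u}.symm.toLinearMap.comp (b.coord i)))
  have hsum {Y Z : FreeFinMod.{u} R} (f : Module.Free.ChooseBasisIndex R X.obj → (Y ⟶ Z))
      (y : Y.obj) : (∑ i, f i).hom.hom y = ∑ i, (f i).hom.hom y := by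
    let ev : (Y ⟶ Z) →+ Z.obj := ⟨⟨fun f => f.hom.hom y, rfl⟩, fun _ _ => rfl⟩
    exact map_sum ev f Finset.univ
  have hp : ∑ i, p i ≫ toHom (b i) = 𝟙 X := hom_ext fun z => by
    rw [hsum]
    exact b.sum_repr z
  have hzp (z : X.obj) (i) : toHom z ≫ p i = scalar (b.repr z i) := hom_ext fun r => by
    refine ULift.ext _ _ ?_
    change b.repr (r.down • z) i = b.repr z i * r.down
    rw [map_smul, mul_comm]
    rfl
  -- The inverse expands `u` along the decomposition of the identity of `X` given by a basis.
  let g (u : U.obj X) : U.obj (unit R) ⊗[S] X.obj := ∑ i, (U.map (p i)).hom u ⊗ₜ[S] b i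
  refine Function.bijective_iff_has_inverse.2
    ⟨g, fun (t : U.obj (unit R) ⊗[S] X.obj) => ?_, fun u => ?_⟩
  · have hg (x y) : g (x + y) = g x + g y := by
      simp only [g, map_add, add_tmul, Finset.sum_add_distrib]
    have hg0 : g 0 = 0 := by simp [g]
    change g (((evalTrans U S).app X).hom t) = t
    induction t with
    | zero => exact (congrArg g (map_zero _)).trans hg0
    | add x y hx hy =>
      exact (congrArg g (map_add ((evalTrans U S).app X).hom x y)).trans
        ((hg _ _).trans (congrArg₂ (· + ·) hx hy))
    | tmul n z =>
      have h1 (i) : (U.map (p i)).hom ((U.map (toHom z)).hom n) ⊗ₜ[S] b i =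
          n ⊗ₜ[S] (b.repr z i • b i) := by
        have h2 : (U.map (p i)).hom ((U.map (toHom z)).hom n) = b.repr z i • n := by
          rw [unitModule_smul, ← hzp, U.map_comp]
          rfl
        rw [h2]
        exact smul_tmul (⟨b.repr z i, hS ▸ trivial⟩ : S) n (b i)
      change ∑ i, (U.map (p i)).hom ((U.map (toHom z)).hom n) ⊗ₜ[S] b i = n ⊗ₜ[S] z
      simp only [h1]
      rw [← tmul_sum, b.sum_repr]
  · have h1 : ((evalTrans U S).app X).hom (g u) =
        ∑ i, (U.map (toHom (b i))).hom ((U.map (p i)).hom u) :=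
      map_sum ((evalTrans U S).app X).hom (fun i => (U.map (p i)).hom u ⊗ₜ[S] b i) Finset.univ
    have h2 : ∑ i, U.map (p i) ≫ U.map (toHom (b i)) = 𝟙 (U.obj X) := by
      rw [← U.map_id, ← hp, U.map_sum]
      simp only [U.map_comp]
    have h3 := congrArg (fun f => f.hom u) h2
    refine h1.trans (Eq.trans ?_ h3)
    simp

/-- If `U R` is projective over `R'`, then the cohomology of `Hom(U,V)` vanishes in degrees greater
than the number of variables. -/
theorem vanishesAbove_of_projective {σ : Type} [Fintype σ] [Algebra k R']
    (U V : FreeFinMod.{u} (MvPolynomial σ k) ⥤ ModuleCat.{max u v} R')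
    [U.Additive] [U.Linear k] [V.Additive] [V.Linear k]
    [Module.Projective R' (U.obj (unit _))] :
    HomDeg.VanishesAbove k U V (Fintype.card σ) := by
  have hk (c : k) (n : U.obj (unit (MvPolynomial σ k))) := algebraMap_unitModule_smul U c n
  have h := vanishesAbove_tensorFunctor.{u, v} hk V Finset.univ
  have this (S) := tensorFunctor_linear.{u, v} (R' := R') S _ hk
  let e := evalTrans U (MvPolynomial.supported k ((Finset.univ : Finset σ) : Set σ))
  have : IsIso e := by
    rw [NatTrans.isIso_iff_isIso_app]
    intro X
    rw [ConcreteCategory.isIso_iff_bijective]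
    exact evalTrans_app_bijective U _ (by simp) X
  exact HomDeg.VanishesAbove.of_iso (asIso e) h

end UnitValue

end FreeFinMod

theorem mainTheorem5 (d d' : ℕ)
    (U V : FreeFinMod.{u} (MvPolynomial (Fin d) ℂ) ⥤ FreeFinMod.{v} (MvPolynomial (Fin d') ℂ))
    [U.Additive] [U.Linear ℂ] [V.Additive] [V.Linear ℂ] (n : ℕ) (hn : d < n) :
    CategoryTheory.Limits.IsZero ((homComplex (k := ℂ) U V).homology n) := by
  let I : FreeFinMod.{v} (MvPolynomial (Fin d') ℂ) ⥤ ModuleCat.{v} (MvPolynomial (Fin d') ℂ) :=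
    ObjectProperty.ι _
  have : I.Additive := ⟨rfl⟩
  have : I.Linear ℂ := ⟨fun _ _ => rfl⟩
  let G : FreeFinMod.{v} (MvPolynomial (Fin d') ℂ) ⥤
      ModuleCat.{max u v} (MvPolynomial (Fin d') ℂ) := I ⋙ ModuleCat.uliftFunctor.{u, v} _
  have : (ModuleCat.uliftFunctor.{u, v} (MvPolynomial (Fin d') ℂ)).Linear ℂ :=
    ⟨fun _ _ => rfl⟩
  have : Module.Projective (MvPolynomial (Fin d') ℂ) ((U ⋙ G).obj (FreeFinMod.unit _)) := by
    have : Module.Free _ (U.obj (FreeFinMod.unit _)).obj := (U.obj _).property.1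
    exact inferInstanceAs (Module.Projective _ (ULift.{u} (U.obj (FreeFinMod.unit _)).obj))
  have h := FreeFinMod.vanishesAbove_of_projective.{u, v} (k := ℂ) (U ⋙ G) (V ⋙ G)
  rw [Fintype.card_fin] at h
  exact (HomDeg.VanishesAbove.of_comp G h).isZero_homology hn
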